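/- Let $\omega\subset\mathbb{R}^2$ be a bounded domain with smooth boundary, let $\omega_0\Subset\omega$, and let $\kappa_-,\kappa_+,\gamma_-,\gamma_+>0$ and $\varepsilon_0>0$ be fixed. For $0<\varepsilon\le\varepsilon_0$ let $r_\varepsilon>0$ and $\alpha_\varepsilon$ satisfy $$\kappa_-\le\alpha_\varepsilon\,\pi r_\varepsilon^2\le\kappa_+,\qquad \frac{2\pi}{\gamma_+}\le-\varepsilon^2\ln r_\varepsilon\le\frac{2\pi}{\gamma_-}.$$ For $(m,n)\in\mathbb{Z}^2$ let $D_{m,n,\varepsilon}$ be the disc of radius $\varepsilon r_\varepsilon$ centred at $(m\varepsilon,n\varepsilon)$, let $D_\varepsilon$ be the union of those discs $D_{m,n,\varepsilon}$ that are contained in $\omega_0$, and let $a_\varepsilon=\alpha_\varepsilon$ in $D_\varepsilon$ and $a_\varepsilon=1$ in $\omega\setminus D_\varepsilon$. Then for every $s\in[2,\infty)$ there is a constant $C(s)>0$, depending only on $s$ and the fixed data $\omega,\omega_0,\kappa_\pm,\gamma_\pm,\varepsilon_0$ (and not on $\varepsilon$, $r_\varepsilon$, $\alpha_\varepsilon$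 or $v$), such that for all $0<\varepsilon\le\varepsilon_0$ $$\int_\omega a_\varepsilon|v|^s\,dx\le C(s)\,\varepsilon^{2-s}\Big(\int_\omega a_\varepsilon|\nabla v|^2\,dx\Big)^{s/2}\qquad\text{for all } v\in H^1_0(\omega).$$ In particular the left-hand side is finite. -/

import Mathlib

open MeasureTheory Filter Topology

/-- The Euclidean plane. -/
abbrev Plane : Type := EuclideanSpace ℝ (Fin 2)

/-- `φ ∈ C_c^∞(ω)`. -/
def IsTestFunction (ω : Set Plane) (φ : Plane → ℝ) : Prop :=
  ContDiff ℝ ((⊤ : ℕ∞) : WithTop ℕ∞) φ ∧ HasCompactSupport φ ∧ tsupport φ ⊆ ω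

/-- `g` is the weak (distributional) gradient of `v` on `ω`. -/
def HasWeakGradient (ω : Set Plane) (v : Plane → ℝ) (g : Plane → Plane) : Prop :=
  LocallyIntegrableOn v ω ∧ LocallyIntegrableOn g ω ∧
    ∀ φ : Plane → ℝ, IsTestFunction ω φ →
      ∫ x in ω, v x • gradient φ x = -∫ x in ω, φ x • g x

/-- `v ∈ H¹₀(ω)`: `v` and its weak gradient lie in `L²(ω)`, and `v` is the limit in `H¹(ω)` of a
sequence of functions in `C_c^∞(ω)`. Values of `v` outside `ω` are irrelevant. -/
def MemH10 (ω : Set Plane) (v : Plane → ℝ) : Prop :=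
  MemLp v 2 (volume.restrict ω) ∧
    ∃ g : Plane → Plane, MemLp g 2 (volume.restrict ω) ∧ HasWeakGradient ω v g ∧
      ∃ φ : ℕ → Plane → ℝ, (∀ n, IsTestFunction ω (φ n)) ∧
        Tendsto (fun n => eLpNorm (fun x => φ n x - v x) 2 (volume.restrict ω)) atTop (𝓝 0) ∧
        Tendsto (fun n => eLpNorm (fun x => gradient (φ n) x - g x) 2 (volume.restrict ω))
          atTop (𝓝 0)

/-- The disc of radius `ε r` centred at `(m ε, n ε)`. -/
def rodDisc (ε r : ℝ) (m n : ℤ) : Set Plane :=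
  Metric.ball (!₂[(m : ℝ) * ε, (n : ℝ) * ε] : Plane) (ε * r)

/-- The set of indices of those discs that are contained in `ω₀`. -/
def rodIndices (ω₀ : Set Plane) (ε r : ℝ) : Set (ℤ × ℤ) :=
  {p | rodDisc ε r p.1 p.2 ⊆ ω₀}

/-- The union of all discs of the lattice that are contained in `ω₀`: the cross section of the
reinforced region. -/
def rods (ω₀ : Set Plane) (ε r : ℝ) : Set Plane :=
  ⋃ p ∈ rodIndices ω₀ ε r, rodDisc ε r p.1 p.2

open Classical in
/-- The conductivity: `α` in the rods and `1` elsewhere. It does not depend on the coordinate along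
the rods, hence is a function on the plane. -/
noncomputable def conductivity (ω₀ : Set Plane) (ε r α : ℝ) (x : Plane) : ℝ :=
  if x ∈ rods ω₀ ε r then α else 1

/-!
The conductivity is bounded below by a positive constant, so the inequality only has to be proved
with the unweighted energy `E = ∫ ‖∇v‖²` on the right, and, by density and Fatou's lemma
(`MemH10.lintegral_le_of_testFunction`), only for smooth functions `φ` with compact support in `ω`,
regarded as functions on the whole plane. Where the conductivity is `1`, the Sobolev inequality
`∫ |φ|^s ≤ C E^(s/2)` (`exists_sobolev_const`) is enough, because `ε^(2-s)` is bounded below.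

In the rods, `α` times the area of a disc is of order `ε²`, so the mean of `|φ|^s` over each disc of
radius `ε r` has to be controlled by what happens in its cell of size `ε`. Rescaling and cutting off
at twice the radius, the Sobolev inequality bounds this mean by the local energy and the mean square
of `φ` over the doubled disc. Integrating along rays, the mean square on the small disc is bounded
by the mean square on the cell plus `log (1 / r)` times the energy in the cell
(`lintegral_ball_comp_smul_sq_le`). The logarithm, to the first power, is at most of order `ε⁻²` by
hypothesis, which gives `ε² (ε⁻² E_cell)^(s/2) = ε^(2-s) E_cell^(s/2)` per cell, plus a multiple of
the integral of `|φ|^s` over the cell. The cells are disjoint and `s / 2 ≥ 1`, so the local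
bounds add up to the global one (`exists_setLIntegral_rods_le`). If `r` is not small, `α` is
bounded and the plain Sobolev inequality suffices.
-/

open scoped ENNReal NNReal

/-! ### Change of variables and the Sobolev inequality with bounded support -/

/-- Change of variables `y = c + R x` in the plane; no measurability of `F` is needed, since the
map is a homeomorphism. -/
theorem lintegral_comp_add_smul (c : Plane) {R : ℝ} (hR : 0 < R) (F : Plane → ℝ≥0∞) :
    ENNReal.ofReal (R ^ 2) * ∫⁻ x, F (c + R • x) = ∫⁻ y, F y := by
  have hemb : MeasurableEmbedding (fun x : Plane => R • x) :=
    (Homeomorph.smulOfNeZero R hR.ne').measurableEmbedding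
  have h1 : ∫⁻ x, F (c + R • x) = ENNReal.ofReal |(R ^ 2)⁻¹| * ∫⁻ y, F y := by
    rw [← lintegral_add_left_eq_self F c,
      ← hemb.lintegral_map (fun y => F (c + y)), Measure.map_addHaar_smul volume hR.ne',
      lintegral_smul_measure]
    simp
  have h2 : 0 < R ^ 2 := by positivity
  rw [h1, ← mul_assoc, ← ENNReal.ofReal_mul h2.le, abs_of_pos (inv_pos.2 h2),
    mul_inv_cancel₀ h2.ne', ENNReal.ofReal_one, one_mul]

open scoped Classical in
theorem setLIntegral_ball_comp_add_smul (c : Plane) {R : ℝ} (hR : 0 < R) (t : ℝ)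
    (F : Plane → ℝ≥0∞) :
    ENNReal.ofReal (R ^ 2) * ∫⁻ x in Metric.ball 0 t, F (c + R • x) =
      ∫⁻ y in Metric.ball c (R * t), F y := by
  rw [← lintegral_indicator Metric.isOpen_ball.measurableSet,
    ← lintegral_indicator Metric.isOpen_ball.measurableSet,
    ← lintegral_comp_add_smul c hR ((Metric.ball c (R * t)).indicator F)]
  congr 1
  refine lintegral_congr fun x => ?_
  have : (c + R • x ∈ Metric.ball c (R * t)) ↔ x ∈ Metric.ball (0 : Plane) t := by
    rw [Metric.mem_ball, Metric.mem_ball, dist_self_add_left, dist_zero_right, norm_smul,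
      Real.norm_of_nonneg hR.le, mul_lt_mul_iff_right₀ hR]
  simp only [Set.indicator_apply, this]

/-- Sobolev inequality in the plane for every finite exponent `s ≥ 2`, for functions supported in a
fixed bounded set. The Gagliardo–Nirenberg–Sobolev inequality requires a gradient exponent below the
dimension, so it is used with `p = 2 s / (s + 2) < 2`, whose Sobolev conjugate is `s`, and the `L^p`
norm of the gradient is bounded by its `L²` norm on the bounded support. -/
theorem exists_sobolev_const {s : ℝ} (hs : 2 ≤ s) {A : Set Plane} (hA : Bornology.IsBounded A) :
    ∃ C : ℝ≥0, ∀ u : Plane → ℝ, ContDiff ℝ 1 u → Function.support u ⊆ A →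
      ∫⁻ x, ‖u x‖ₑ ^ s ≤ C * (∫⁻ x, ‖fderiv ℝ u x‖ₑ ^ 2) ^ (s / 2) := by
  have hs0 : 0 < s := by linarith
  set K : Set Plane := closure A
  have hK : Bornology.IsBounded K := hA.closure
  have hKvol : volume K ≠ ∞ := hK.measure_lt_top.ne
  -- The exponent with `1 / p - 1 / 2 = 1 / s`.
  let p : ℝ≥0 := ⟨2 * s / (s + 2), by positivity⟩
  let q : ℝ≥0 := ⟨s, hs0.le⟩
  have hp : (p : ℝ) = 2 * s / (s + 2) := rfl
  have hq : (q : ℝ) = s := rfl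
  have hp1 : 1 ≤ p := by
    rw [← NNReal.coe_le_coe, hp, NNReal.coe_one, le_div_iff₀ (by linarith)]; linarith
  have hp2 : p < 2 := by
    rw [← NNReal.coe_lt_coe, hp, NNReal.coe_ofNat, div_lt_iff₀ (by linarith)]; linarith
  have hdim : Module.finrank ℝ Plane = 2 := by simp
  have hpq : (p : ℝ)⁻¹ - (Module.finrank ℝ Plane : ℝ)⁻¹ ≤ (q : ℝ)⁻¹ := by
    rw [hp, hq, hdim]; push_cast
    apply le_of_eq; field_simp; ring
  set C₁ := eLpNormLESNormFDerivOfLeConst ℝ (volume : Measure Plane) A p q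
  set V : ℝ≥0∞ := volume K ^ (1 / (p : ℝ≥0∞).toReal - 1 / (2 : ℝ≥0∞).toReal)
  have hV : V ≠ ∞ := by
    refine ENNReal.rpow_ne_top_of_nonneg ?_ hKvol
    have : (p : ℝ) ≤ 2 := by exact_mod_cast hp2.le
    have h0 : (0 : ℝ) < p := by exact_mod_cast (zero_lt_one.trans_le hp1)
    simpa using inv_anti₀ h0 this
  have hC : ((C₁ : ℝ≥0∞) * V) ^ s ≠ ∞ :=
    ENNReal.rpow_ne_top_of_nonneg hs0.le (ENNReal.mul_ne_top (by simp) hV)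
  refine ⟨(((C₁ : ℝ≥0∞) * V) ^ s).toNNReal, fun u hu hsupp => ?_⟩
  have h1 := eLpNorm_le_eLpNorm_fderiv_of_le (volume : Measure Plane) hu hsupp hp1
    (by rw [hdim]; exact_mod_cast hp2) hpq hA
  have hDsupp : Function.support (fderiv ℝ u) ⊆ K :=
    (support_fderiv_subset ℝ).trans (closure_mono hsupp)
  have h2 : eLpNorm (fderiv ℝ u) p volume ≤ eLpNorm (fderiv ℝ u) 2 volume * V := by
    have hr : eLpNorm (fun x => ‖fderiv ℝ u x‖) p (volume.restrict K) =
        eLpNorm (fun x => ‖fderiv ℝ u x‖) p volume :=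
      eLpNorm_restrict_eq_of_support_subset fun x hx => hDsupp (by simpa using hx)
    rw [← eLpNorm_norm, ← hr, eLpNorm_norm]
    refine (eLpNorm_le_eLpNorm_mul_rpow_measure_univ (q := 2) (by exact_mod_cast hp2.le)
      (hu.continuous_fderiv one_ne_zero).aestronglyMeasurable).trans ?_
    rw [Measure.restrict_apply_univ]
    gcongr
    exact Measure.restrict_le_self
  have hq0 : (q : ℝ≥0∞) ≠ 0 := by
    have : q ≠ 0 := by rw [Ne, ← NNReal.coe_inj]; exact hs0.ne'
    exact_mod_cast this
  rw [eLpNorm_eq_lintegral_rpow_enorm_toReal hq0 (by simp), ENNReal.coe_toReal, hq] at h1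
  rw [eLpNorm_eq_lintegral_rpow_enorm_toReal (p := 2) (by simp) (by simp)] at h2
  simp only [ENNReal.toReal_ofNat, ENNReal.rpow_ofNat] at h2
  have h3 : (∫⁻ x, ‖u x‖ₑ ^ s) ^ (1 / s) ≤
      (C₁ * V) * (∫⁻ x, ‖fderiv ℝ u x‖ₑ ^ 2) ^ (1 / 2 : ℝ) :=
    (h1.trans (mul_le_mul' le_rfl h2)).trans (le_of_eq (by ring))
  have h4 := ENNReal.rpow_le_rpow h3 hs0.le
  rw [← ENNReal.rpow_mul, one_div_mul_cancel hs0.ne', ENNReal.rpow_one,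
    ENNReal.mul_rpow_of_nonneg _ _ hs0.le, ← ENNReal.rpow_mul, one_div_mul_eq_div] at h4
  rwa [ENNReal.coe_toNNReal hC]

/-! ### The logarithmic estimate on shrinking discs -/

/-- Increment along a ray: the fundamental theorem of calculus and the Cauchy–Schwarz inequality with
the weight `t`, which gives the logarithm `∫_δ^1 dt / t` to the first power only. -/
theorem enorm_sub_comp_smul_sq_le {f : Plane → ℝ} (hf : ContDiff ℝ 1 f) (x : Plane) {δ : ℝ}
    (hδ : 0 < δ) (hδ1 : δ ≤ 1) :
    ‖f x - f (δ • x)‖ₑ ^ 2 ≤ ENNReal.ofReal (-Real.log δ) *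
      ∫⁻ t in Set.Ioc δ 1, ENNReal.ofReal t * (‖fderiv ℝ f (t • x)‖ₑ * ‖x‖ₑ) ^ 2 := by
  have hD : Continuous fun t : ℝ => fderiv ℝ f (t • x) :=
    (hf.continuous_fderiv one_ne_zero).comp (by fun_prop)
  have hftc : ∫ t in δ..1, fderiv ℝ f (t • x) x = f x - f (δ • x) := by
    have := intervalIntegral.integral_eq_sub_of_hasDerivAt (a := δ) (b := 1)
      (f := fun t : ℝ => f (t • x)) (f' := fun t => fderiv ℝ f (t • x) x) (fun t _ => by
        have h1 := (hf.differentiable one_ne_zero (t • x)).hasFDerivAt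
        have h2 : HasDerivAt (fun t : ℝ => t • x) x t := by
          simpa using (hasDerivAt_id t).smul_const x
        exact h1.comp_hasDerivAt t h2)
      ((hD.clm_apply continuous_const).intervalIntegrable _ _)
    simpa using this
  have h1 : ‖f x - f (δ • x)‖ₑ ≤ ∫⁻ t in Set.Ioc δ 1,
      ((fun t => ENNReal.ofReal (√t)⁻¹) *
        fun t => ENNReal.ofReal √t * (‖fderiv ℝ f (t • x)‖ₑ * ‖x‖ₑ)) t := by
    rw [← hftc, intervalIntegral.integral_of_le hδ1]
    refine (enorm_integral_le_lintegral_enorm _).trans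
      (setLIntegral_mono_ae' measurableSet_Ioc (ae_of_all _ fun t ht => ?_))
    have : 0 < √t := Real.sqrt_pos.2 (hδ.trans ht.1)
    simp only [Pi.mul_apply]
    rw [← mul_assoc, ← ENNReal.ofReal_mul (inv_nonneg.2 this.le), inv_mul_cancel₀ this.ne',
      ENNReal.ofReal_one, one_mul]
    exact ContinuousLinearMap.le_opENorm _ _
  have h2 := h1.trans (ENNReal.lintegral_mul_le_Lp_mul_Lq _ Real.HolderConjugate.two_two
    (by fun_prop) (by fun_prop))
  have h3 : ∫⁻ t in Set.Ioc δ 1, ENNReal.ofReal (√t)⁻¹ ^ (2 : ℝ) =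
      ENNReal.ofReal (-Real.log δ) := by
    have e : ∫ t in Set.Ioc δ 1, t⁻¹ = -Real.log δ := by
      rw [← intervalIntegral.integral_of_le hδ1, integral_inv_of_pos hδ one_pos]
      simp
    rw [← e, ofReal_integral_eq_lintegral_ofReal]
    · refine setLIntegral_congr_fun measurableSet_Ioc fun t ht => ?_
      have h0 : 0 < t := hδ.trans ht.1
      simp only [ENNReal.rpow_ofNat]
      rw [← ENNReal.ofReal_pow (by positivity), inv_pow, Real.sq_sqrt h0.le]
    · rw [← IntegrableOn, ← intervalIntegrable_iff_integrableOn_Ioc_of_le hδ1]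
      refine intervalIntegral.intervalIntegrable_inv (fun t ht => ?_) continuousOn_id
      rw [Set.uIcc_of_le hδ1] at ht
      exact (hδ.trans_le ht.1).ne'
    · refine (ae_restrict_iff' measurableSet_Ioc).2 (ae_of_all _ fun t ht => ?_)
      exact inv_nonneg.2 (hδ.trans ht.1).le
  have h4 : ∫⁻ t in Set.Ioc δ 1,
        (ENNReal.ofReal √t * (‖fderiv ℝ f (t • x)‖ₑ * ‖x‖ₑ)) ^ (2 : ℝ) =
      ∫⁻ t in Set.Ioc δ 1, ENNReal.ofReal t * (‖fderiv ℝ f (t • x)‖ₑ * ‖x‖ₑ) ^ 2 := by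
    refine setLIntegral_congr_fun measurableSet_Ioc fun t ht => ?_
    have h0 : 0 < t := hδ.trans ht.1
    simp only [ENNReal.rpow_ofNat]
    rw [mul_pow, ← ENNReal.ofReal_pow (by positivity), Real.sq_sqrt h0.le]
  rw [h3, h4] at h2
  refine (pow_le_pow_left' h2 2).trans (le_of_eq ?_)
  rw [mul_pow]
  simp only [← ENNReal.rpow_natCast, ← ENNReal.rpow_mul]
  norm_num

theorem setLIntegral_inv_cube_le (δ : ℝ) {ρ : ℝ} (hρ : 0 < ρ) :
    ∫⁻ t in Set.Ioc δ 1, ENNReal.ofReal (t ^ (-3 : ℝ)) * (if ρ < t then 1 else 0) ≤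
      ENNReal.ofReal (ρ ^ 2)⁻¹ := by
  calc ∫⁻ t in Set.Ioc δ 1, ENNReal.ofReal (t ^ (-3 : ℝ)) * (if ρ < t then 1 else 0)
      ≤ ∫⁻ t, ENNReal.ofReal (t ^ (-3 : ℝ)) * (if ρ < t then 1 else 0) :=
        setLIntegral_le_lintegral _ _
    _ = ∫⁻ t in Set.Ioi ρ, ENNReal.ofReal (t ^ (-3 : ℝ)) := by
        rw [← lintegral_indicator measurableSet_Ioi]
        congr 1; ext t
        by_cases h : ρ < t <;> simp [h]
    _ = ENNReal.ofReal (∫ t in Set.Ioi ρ, t ^ (-3 : ℝ)) := by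
        rw [ofReal_integral_eq_lintegral_ofReal
          (integrableOn_Ioi_rpow_of_lt (by norm_num) hρ)]
        refine (ae_restrict_iff' measurableSet_Ioi).2 (ae_of_all _ fun t ht => ?_)
        exact Real.rpow_nonneg (hρ.trans ht).le _
    _ ≤ ENNReal.ofReal (ρ ^ 2)⁻¹ := by
        apply ENNReal.ofReal_le_ofReal
        rw [integral_Ioi_rpow_of_lt (by norm_num) hρ]
        have : ρ ^ (-3 + 1 : ℝ) = (ρ ^ 2)⁻¹ := by
          rw [show (-3 + 1 : ℝ) = -((2 : ℕ) : ℝ) by norm_num, Real.rpow_neg hρ.le,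
            Real.rpow_natCast]
        rw [this]
        have : 0 < (ρ ^ 2)⁻¹ := by positivity
        rw [show (-3 + 1 : ℝ) = -2 by norm_num, neg_div_neg_eq]
        linarith

open scoped Classical in
/-- The radial energies at all scales `t ∈ (δ, 1]` add up to at most one full energy, with no factor
growing as `δ → 0`: after the substitution `y = t x` the weight at `y` is
`‖y‖² ∫_{t > ‖y‖} t⁻³ dt ≤ 1`. -/
theorem lintegral_radial_le {f : Plane → ℝ} (hf : ContDiff ℝ 1 f) {δ : ℝ} (hδ : 0 < δ) :
    ∫⁻ x in Metric.ball (0 : Plane) 1, ∫⁻ t in Set.Ioc δ 1,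
        ENNReal.ofReal t * (‖fderiv ℝ f (t • x)‖ₑ * ‖x‖ₑ) ^ 2 ≤
      ∫⁻ x in Metric.ball (0 : Plane) 1, ‖fderiv ℝ f x‖ₑ ^ 2 := by
  have hD := hf.continuous_fderiv one_ne_zero
  rw [lintegral_lintegral_swap]
  swap
  · have : Continuous fun z : Plane × ℝ => fderiv ℝ f (z.2 • z.1) := hD.comp (by fun_prop)
    apply Measurable.aemeasurable
    simp only [Function.uncurry_def]
    fun_prop
  have key : ∀ t ∈ Set.Ioc δ 1, ∫⁻ x in Metric.ball (0 : Plane) 1,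
        ENNReal.ofReal t * (‖fderiv ℝ f (t • x)‖ₑ * ‖x‖ₑ) ^ 2 =
      ∫⁻ y in Metric.ball (0 : Plane) 1,
        (‖fderiv ℝ f y‖ₑ * ‖y‖ₑ) ^ 2 *
          (ENNReal.ofReal (t ^ (-3 : ℝ)) * (if ‖y‖ < t then 1 else 0)) := by
    intro t ht
    have h0 : 0 < t := hδ.trans ht.1
    have h2 : ENNReal.ofReal (t ^ 2) ≠ 0 := by simp; positivity
    rw [← ENNReal.mul_right_inj h2 ENNReal.ofReal_ne_top]
    have e := setLIntegral_ball_comp_add_smul 0 h0 1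
      (fun y => ENNReal.ofReal t⁻¹ * (‖fderiv ℝ f y‖ₑ * ‖y‖ₑ) ^ 2)
    have e1 : ∀ x : Plane, ENNReal.ofReal t * (‖fderiv ℝ f (t • x)‖ₑ * ‖x‖ₑ) ^ 2 =
        ENNReal.ofReal t⁻¹ * (‖fderiv ℝ f (0 + t • x)‖ₑ * ‖(0 : Plane) + t • x‖ₑ) ^ 2 := by
      intro x
      rw [zero_add, enorm_smul, Real.enorm_of_nonneg h0.le, mul_pow, mul_pow, mul_pow,
        ← ENNReal.ofReal_pow h0.le,
        show ENNReal.ofReal t = ENNReal.ofReal t⁻¹ * ENNReal.ofReal (t ^ 2) by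
          rw [← ENNReal.ofReal_mul (by positivity)]; congr 1; field_simp]
      ring
    rw [lintegral_congr e1]
    rw [e, mul_one, ← lintegral_const_mul' _ _ ENNReal.ofReal_ne_top,
      ← lintegral_indicator Metric.isOpen_ball.measurableSet,
      ← lintegral_indicator Metric.isOpen_ball.measurableSet]
    congr 1; ext y
    by_cases hy : ‖y‖ < t
    · have hy1 : ‖y‖ < 1 := hy.trans_le ht.2
      simp only [Set.indicator_apply, mem_ball_zero_iff, hy, hy1, if_true, mul_one]
      rw [mul_left_comm, ← ENNReal.ofReal_mul (by positivity), mul_comm]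
      congr 2
      rw [show (-3 : ℝ) = -((3 : ℕ) : ℝ) by norm_num, Real.rpow_neg h0.le, Real.rpow_natCast]
      field_simp
    · simp [Set.indicator_apply, hy]
  rw [setLIntegral_congr_fun measurableSet_Ioc key, lintegral_lintegral_swap]
  · refine lintegral_mono fun y => ?_
    rcases eq_or_ne y 0 with rfl | hy
    · simp
    have hy0 : 0 < ‖y‖ := norm_pos_iff.2 hy
    rw [lintegral_const_mul']
    swap
    · finiteness
    refine (mul_le_mul_right (setLIntegral_inv_cube_le δ hy0) _).trans (le_of_eq ?_)
    rw [mul_pow, mul_assoc, ← ofReal_norm y, ← ENNReal.ofReal_pow hy0.le,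
      ← ENNReal.ofReal_mul (by positivity), mul_inv_cancel₀ (by positivity)]
    simp
  · apply Measurable.aemeasurable
    simp only [Function.uncurry_def]
    refine Measurable.mul (by fun_prop) (Measurable.mul ?_ (Measurable.ite ?_ ?_ ?_))
    · exact (measurable_fst.pow_const _).ennreal_ofReal
    · exact measurableSet_lt (by fun_prop) (by fun_prop)
    · fun_prop
    · fun_prop

/-- The mean square of `f` on the disc of radius `δ` is bounded by that on the unit disc plus
`log (1 / δ)` times the energy. The logarithm is to the first power, which is what the lattice
estimate needs. -/
theorem lintegral_ball_comp_smul_sq_le {f : Plane → ℝ} (hf : ContDiff ℝ 1 f) {δ : ℝ}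
    (hδ : 0 < δ) (hδ1 : δ ≤ 1) :
    ∫⁻ x in Metric.ball (0 : Plane) 1, ‖f (δ • x)‖ₑ ^ 2 ≤
      2 * (∫⁻ x in Metric.ball (0 : Plane) 1, ‖f x‖ₑ ^ 2) +
      2 * ENNReal.ofReal (-Real.log δ) *
        ∫⁻ x in Metric.ball (0 : Plane) 1, ‖fderiv ℝ f x‖ₑ ^ 2 := by
  have hpt : ∀ x, ‖f (δ • x)‖ₑ ^ 2 ≤ 2 * ‖f x‖ₑ ^ 2 + 2 * ‖f x - f (δ • x)‖ₑ ^ 2 := by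
    intro x
    have h : ‖f (δ • x)‖ₑ ≤ ‖f x‖ₑ + ‖f x - f (δ • x)‖ₑ := by
      have := enorm_sub_le (a := f x) (b := f x - f (δ • x))
      simpa using this
    have h2 := ENNReal.rpow_add_le_mul_rpow_add_rpow ‖f x‖ₑ ‖f x - f (δ • x)‖ₑ
      (p := 2) (by norm_num)
    simp only [ENNReal.rpow_ofNat] at h2
    norm_num at h2
    exact (pow_le_pow_left' h 2).trans (h2.trans (by rw [mul_add]))
  have hc := hf.continuous
  calc _ ≤ ∫⁻ x in Metric.ball (0 : Plane) 1,
        (2 * ‖f x‖ₑ ^ 2 + 2 * (ENNReal.ofReal (-Real.log δ) * ∫⁻ t in Set.Ioc δ 1,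
          ENNReal.ofReal t * (‖fderiv ℝ f (t • x)‖ₑ * ‖x‖ₑ) ^ 2)) :=
        lintegral_mono fun x => (hpt x).trans (by
          gcongr; exact enorm_sub_comp_smul_sq_le hf x hδ hδ1)
    _ = 2 * (∫⁻ x in Metric.ball (0 : Plane) 1, ‖f x‖ₑ ^ 2) +
        2 * ENNReal.ofReal (-Real.log δ) * ∫⁻ x in Metric.ball (0 : Plane) 1,
          ∫⁻ t in Set.Ioc δ 1, ENNReal.ofReal t * (‖fderiv ℝ f (t • x)‖ₑ * ‖x‖ₑ) ^ 2 := by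
        rw [lintegral_add_left (by fun_prop), lintegral_const_mul' _ _ (by simp),
          lintegral_const_mul' _ _ (by simp), lintegral_const_mul' _ _ (by simp), mul_assoc]
    _ ≤ _ := add_le_add le_rfl (mul_le_mul' le_rfl (lintegral_radial_le hf hδ))

theorem rpow_setLIntegral_sq_le {s : ℝ} (hs : 2 ≤ s) {f : Plane → ℝ} (hf : Continuous f)
    (A : Set Plane) :
    (∫⁻ x in A, ‖f x‖ₑ ^ 2) ^ (s / 2) ≤ volume A ^ (s / 2 - 1) * ∫⁻ x in A, ‖f x‖ₑ ^ s := by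
  have hs0 : 0 < s := by linarith
  have h := eLpNorm_le_eLpNorm_mul_rpow_measure_univ (μ := volume.restrict A) (p := 2)
    (q := ENNReal.ofReal s) (f := f)
    (by rw [← ENNReal.ofReal_ofNat]; exact ENNReal.ofReal_le_ofReal hs) hf.aestronglyMeasurable
  rw [eLpNorm_eq_lintegral_rpow_enorm_toReal (by simp) (by simp),
    eLpNorm_eq_lintegral_rpow_enorm_toReal (by simpa using hs0) (by simp),
    ENNReal.toReal_ofReal hs0.le, Measure.restrict_apply_univ] at h
  simp only [ENNReal.toReal_ofNat, ENNReal.rpow_ofNat] at h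
  have h4 := ENNReal.rpow_le_rpow h hs0.le
  rw [← ENNReal.rpow_mul, ENNReal.mul_rpow_of_nonneg _ _ hs0.le, ← ENNReal.rpow_mul,
    ← ENNReal.rpow_mul, one_div_mul_cancel hs0.ne', ENNReal.rpow_one, one_div_mul_eq_div,
    mul_comm] at h4
  convert h4 using 3
  field_simp

/-! ### The `L^s` estimate on a small disc -/

/-- A cutoff equal to `1` on the unit disc and supported in the disc of radius `2`, with a bound for
the energy of the product with it. -/
theorem exists_bump_energy_const : ∃ (η : ContDiffBump (0 : Plane)) (K : ℝ≥0),
    (∀ x ∈ Metric.ball (0 : Plane) 1, η x = 1) ∧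
    Function.support η ⊆ Metric.ball (0 : Plane) 2 ∧
    ∀ f : Plane → ℝ, ContDiff ℝ 1 f →
      ∫⁻ x, ‖fderiv ℝ (fun y => η y * f y) x‖ₑ ^ 2 ≤
        K * ((∫⁻ x in Metric.ball (0 : Plane) 2, ‖fderiv ℝ f x‖ₑ ^ 2) +
          ∫⁻ x in Metric.ball (0 : Plane) 2, ‖f x‖ₑ ^ 2) := by
  -- Any outer radius below `2` serves; it keeps the closed support inside the open disc.
  let η : ContDiffBump (0 : Plane) := ⟨1, 3 / 2, by norm_num, by norm_num⟩
  have hη : ContDiff ℝ 1 η := η.contDiff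
  obtain ⟨M, hM⟩ : ∃ M, ∀ x, ‖fderiv ℝ η x‖ ≤ M :=
    (hη.continuous_fderiv one_ne_zero).bounded_above_of_compact_support
      (η.hasCompactSupport.fderiv ℝ)
  have hM0 : 0 ≤ M := (norm_nonneg _).trans (hM 0)
  lift M to ℝ≥0 using hM0
  refine ⟨η, 2 + 2 * M ^ 2, ?_, ?_, ?_⟩
  · intro x hx
    exact η.one_of_mem_closedBall (Metric.ball_subset_closedBall hx)
  · rw [η.support_eq]
    exact Metric.ball_subset_ball (by norm_num [η])
  intro f hf
  have hpt : ∀ x, ‖fderiv ℝ (fun y => η y * f y) x‖ₑ ^ 2 ≤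
      (Metric.ball (0 : Plane) 2).indicator (fun x => ((2 + 2 * M ^ 2 : ℝ≥0) : ℝ≥0∞) *
        (‖fderiv ℝ f x‖ₑ ^ 2 + ‖f x‖ₑ ^ 2)) x := by
    intro x
    by_cases hx : x ∈ Metric.ball (0 : Plane) 2
    · rw [Set.indicator_of_mem hx, fderiv_fun_mul (hη.differentiable one_ne_zero x)
        (hf.differentiable one_ne_zero x)]
      have h1 : ‖η x • fderiv ℝ f x + f x • fderiv ℝ η x‖ ^ 2 ≤
          (2 + 2 * (M : ℝ) ^ 2) * (‖fderiv ℝ f x‖ ^ 2 + ‖f x‖ ^ 2) := by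
        have h2 : ‖η x • fderiv ℝ f x + f x • fderiv ℝ η x‖ ≤ ‖fderiv ℝ f x‖ + ‖f x‖ * M := by
          refine (norm_add_le _ _).trans ?_
          rw [norm_smul, norm_smul, Real.norm_of_nonneg η.nonneg]
          gcongr
          · exact mul_le_of_le_one_left (norm_nonneg _) η.le_one
          · exact hM x
        refine (pow_le_pow_left₀ (norm_nonneg _) h2 2).trans ?_
        nlinarith [sq_nonneg (‖fderiv ℝ f x‖ - ‖f x‖ * M), sq_nonneg (M * ‖fderiv ℝ f x‖),
          sq_nonneg ‖f x‖]
      have h3 := ENNReal.ofReal_le_ofReal h1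
      rw [ENNReal.ofReal_pow (norm_nonneg _), ENNReal.ofReal_mul (by positivity),
        ENNReal.ofReal_add (sq_nonneg ‖fderiv ℝ f x‖) (sq_nonneg ‖f x‖),
        ENNReal.ofReal_pow (norm_nonneg _),
        ENNReal.ofReal_pow (norm_nonneg _), ofReal_norm, ofReal_norm, ofReal_norm] at h3
      refine h3.trans (le_of_eq ?_)
      congr 1
      rw [ENNReal.ofReal, ENNReal.coe_inj, ← NNReal.coe_inj, Real.coe_toNNReal _ (by positivity)]
      rfl
    · have : fderiv ℝ (fun y => η y * f y) x = 0 := by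
        by_contra h
        apply hx
        have h1 : x ∈ tsupport (fun y => η y * f y) := support_fderiv_subset ℝ h
        have h2 := closure_mono (Function.support_mul_subset_left η f) h1
        have h3 : x ∈ Metric.closedBall (0 : Plane) (3 / 2) := by
          have := η.tsupport_eq
          rw [tsupport] at this
          rwa [this] at h2
        exact Metric.closedBall_subset_ball (by norm_num) h3
      rw [← ofReal_norm, this, norm_zero]
      simp
  refine (lintegral_mono hpt).trans (le_of_eq ?_)
  rw [lintegral_indicator Metric.isOpen_ball.measurableSet, lintegral_const_mul' _ _ ENNReal.coe_ne_top,
    lintegral_add_right _ (by have := hf.continuous; fun_prop)]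

/-- `L^s` bound on the disc of radius `δ`, seen from the unit disc. The rescaled function `f (δ ·)` is
cut off on the disc of radius `2`; the Sobolev inequality leaves its mean square there, which the
logarithmic estimate transports to the unit disc. Hence `δ ≤ 1 / 2`. -/
theorem exists_lintegral_shrink_le {s : ℝ} (hs : 2 ≤ s) : ∃ C : ℝ≥0,
    ∀ f : Plane → ℝ, ContDiff ℝ 1 f → ∀ δ : ℝ, 0 < δ → δ ≤ 1 / 2 →
      ∫⁻ x in Metric.ball (0 : Plane) 1, ‖f (δ • x)‖ₑ ^ s ≤
        C * ((1 + ENNReal.ofReal (-Real.log δ)) *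
          ∫⁻ x in Metric.ball (0 : Plane) 1, ‖fderiv ℝ f x‖ₑ ^ 2) ^ (s / 2) +
        C * ∫⁻ x in Metric.ball (0 : Plane) 1, ‖f x‖ₑ ^ s := by
  have hs0 : 0 ≤ s / 2 := by linarith
  have hs1 : 1 ≤ s / 2 := by linarith
  obtain ⟨η, K, hη1, hηs, hK⟩ := exists_bump_energy_const
  obtain ⟨C₁, hC₁⟩ := exists_sobolev_const hs (Metric.isBounded_ball (x := (0 : Plane)) (r := 2))
  set V : ℝ≥0∞ := volume (Metric.ball (0 : Plane) 1) ^ (s / 2 - 1)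
  have hV : V ≠ ∞ := ENNReal.rpow_ne_top_of_nonneg (by linarith) measure_ball_lt_top.ne
  set C₂ : ℝ≥0∞ := C₁ * (K * 8 : ℝ≥0∞) ^ (s / 2) * 2 ^ (s / 2 - 1)
  have hC₂ : C₂ ≠ ∞ := by
    refine ENNReal.mul_ne_top (ENNReal.mul_ne_top (by simp) ?_) ?_
    · exact ENNReal.rpow_ne_top_of_nonneg hs0 (ENNReal.mul_ne_top (by simp) (by simp))
    · exact ENNReal.rpow_ne_top_of_nonneg (by linarith) (by simp)
  have hC : C₂ * (1 + V) ≠ ∞ := ENNReal.mul_ne_top hC₂ (by simp [hV])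
  refine ⟨(C₂ * (1 + V)).toNNReal, fun f hf δ hδ hδ2 => ?_⟩
  rw [ENNReal.coe_toNNReal hC]
  set D := ∫⁻ x in Metric.ball (0 : Plane) 1, ‖fderiv ℝ f x‖ₑ ^ 2
  set F := ∫⁻ x in Metric.ball (0 : Plane) 1, ‖f x‖ₑ ^ 2
  set S := ∫⁻ x in Metric.ball (0 : Plane) 1, ‖f x‖ₑ ^ s
  set L := ENNReal.ofReal (-Real.log δ)
  let g : Plane → ℝ := fun x => f (δ • x)
  have hg : ContDiff ℝ 1 g := hf.comp (contDiff_const_smul δ)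
  have hgD : ∀ x, ‖fderiv ℝ g x‖ₑ ^ 2 =
      ENNReal.ofReal (δ ^ 2) * ‖fderiv ℝ f (0 + δ • x)‖ₑ ^ 2 := by
    intro x
    have : fderiv ℝ g x = δ • fderiv ℝ f (δ • x) := fderiv_comp_smul δ
    rw [this, enorm_smul, mul_pow, Real.enorm_of_nonneg hδ.le, ENNReal.ofReal_pow hδ.le, zero_add]
  have hD2 : ∫⁻ x in Metric.ball (0 : Plane) 2, ‖fderiv ℝ g x‖ₑ ^ 2 ≤ D := by
    rw [lintegral_congr hgD, lintegral_const_mul' _ _ ENNReal.ofReal_ne_top,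
      setLIntegral_ball_comp_add_smul 0 hδ 2 (fun y => ‖fderiv ℝ f y‖ₑ ^ 2)]
    exact lintegral_mono_set (Metric.ball_subset_ball (by linarith))
  have hF2 : ∫⁻ x in Metric.ball (0 : Plane) 2, ‖g x‖ₑ ^ 2 ≤ 8 * (F + L * D) := by
    have e := setLIntegral_ball_comp_add_smul 0 (two_pos : (0 : ℝ) < 2) 1 (fun y => ‖g y‖ₑ ^ 2)
    rw [mul_one] at e
    rw [← e]
    have e2 : ∀ x : Plane, ‖g (0 + (2 : ℝ) • x)‖ₑ ^ 2 = ‖f ((δ * 2) • x)‖ₑ ^ 2 := by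
      intro x; simp only [g, zero_add, smul_smul]
    rw [lintegral_congr e2]
    have hl := lintegral_ball_comp_smul_sq_le hf (δ := δ * 2) (by positivity) (by linarith)
    have hlog : ENNReal.ofReal (-Real.log (δ * 2)) ≤ L := by
      apply ENNReal.ofReal_le_ofReal
      have := Real.log_le_log hδ (by linarith : δ ≤ δ * 2)
      linarith
    calc _ ≤ ENNReal.ofReal (2 ^ 2) * (2 * F + 2 * L * D) := by
          refine mul_le_mul' le_rfl (hl.trans (add_le_add le_rfl ?_))
          exact mul_le_mul' (mul_le_mul' le_rfl hlog) le_rfl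
      _ = _ := by
          rw [show ENNReal.ofReal (2 ^ 2) = 4 by norm_num]; ring
  have hu : ∫⁻ x in Metric.ball (0 : Plane) 1, ‖f (δ • x)‖ₑ ^ s ≤
      C₁ * (K * 8 * ((1 + L) * D + F)) ^ (s / 2) := by
    calc _ = ∫⁻ x in Metric.ball (0 : Plane) 1, ‖η x * g x‖ₑ ^ s :=
          setLIntegral_congr_fun Metric.isOpen_ball.measurableSet fun x hx => by
            simp only [hη1 x hx, one_mul, g]
      _ ≤ ∫⁻ x, ‖η x * g x‖ₑ ^ s := setLIntegral_le_lintegral _ _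
      _ ≤ _ := hC₁ _ (η.contDiff.mul hg) ((Function.support_mul_subset_left η g).trans hηs)
      _ ≤ C₁ * (K * (D + 8 * (F + L * D))) ^ (s / 2) := by
          gcongr
          exact (hK g hg).trans (by gcongr)
      _ ≤ _ := by
          rw [mul_assoc (K : ℝ≥0∞)]
          gcongr
          calc D + 8 * (F + L * D) ≤ 8 * D + 8 * (F + L * D) := by
                gcongr
                exact le_mul_of_one_le_left' (by norm_num)
            _ = _ := by ring
  refine hu.trans ?_
  rw [ENNReal.mul_rpow_of_nonneg _ _ hs0]
  calc _ ≤ C₁ * ((K * 8) ^ (s / 2) * (2 ^ (s / 2 - 1) *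
        (((1 + L) * D) ^ (s / 2) + F ^ (s / 2)))) := by
        gcongr
        exact ENNReal.rpow_add_le_mul_rpow_add_rpow _ _ hs1
    _ = C₂ * ((1 + L) * D) ^ (s / 2) + C₂ * F ^ (s / 2) := by simp only [C₂]; ring
    _ ≤ C₂ * ((1 + L) * D) ^ (s / 2) + C₂ * (V * S) := by
        gcongr; exact rpow_setLIntegral_sq_le hs hf.continuous _
    _ ≤ _ := by
        rw [← mul_assoc]
        gcongr
        · exact le_mul_of_one_le_right' le_self_add
        · exact le_add_self

/-- The preceding estimate for the concentric discs of radii `R δ` and `R` around any centre. The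
contribution of the energy carries the factor `δ² R²`, that of `φ` itself only `δ²`. -/
theorem exists_lintegral_disc_le {s : ℝ} (hs : 2 ≤ s) : ∃ C : ℝ≥0,
    ∀ φ : Plane → ℝ, ContDiff ℝ 1 φ → ∀ (c : Plane) (R δ : ℝ), 0 < R → 0 < δ → δ ≤ 1 / 2 →
      ∫⁻ x in Metric.ball c (R * δ), ‖φ x‖ₑ ^ s ≤
        ENNReal.ofReal (δ ^ 2) * (C * ENNReal.ofReal (R ^ 2) *
          ((1 + ENNReal.ofReal (-Real.log δ)) *
            ∫⁻ x in Metric.ball c R, ‖fderiv ℝ φ x‖ₑ ^ 2) ^ (s / 2) +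
        C * ∫⁻ x in Metric.ball c R, ‖φ x‖ₑ ^ s) := by
  obtain ⟨C, hC⟩ := exists_lintegral_shrink_le hs
  refine ⟨C, fun φ hφ c R δ hR hδ hδ2 => ?_⟩
  have hf : ContDiff ℝ 1 fun x => φ (c + R • x) := by fun_prop
  have h := hC _ hf δ hδ hδ2
  have hD : ∀ x, ‖fderiv ℝ (fun x => φ (c + R • x)) x‖ₑ ^ 2 =
      ENNReal.ofReal (R ^ 2) * ‖fderiv ℝ φ (c + R • x)‖ₑ ^ 2 := by
    intro x
    have : fderiv ℝ (fun x => φ (c + R • x)) x = R • fderiv ℝ φ (c + R • x) := by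
      have h1 := fderiv_comp_smul (f := fun y => φ (c + y)) (x := x) R
      rw [h1, fderiv_comp_add_left]
    rw [this, enorm_smul, mul_pow, Real.enorm_of_nonneg hR.le, ENNReal.ofReal_pow hR.le]
  rw [lintegral_congr hD, lintegral_const_mul' _ _ ENNReal.ofReal_ne_top,
    setLIntegral_ball_comp_add_smul c hR 1 (fun y => ‖fderiv ℝ φ y‖ₑ ^ 2), mul_one] at h
  have e1 := setLIntegral_ball_comp_add_smul c (mul_pos hR hδ) 1 (fun y => ‖φ y‖ₑ ^ s)
  have e2 := setLIntegral_ball_comp_add_smul c hR 1 (fun y => ‖φ y‖ₑ ^ s)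
  rw [mul_one] at e1 e2
  simp only [smul_smul] at h
  rw [← e1, ← e2, mul_pow, mul_comm (R ^ 2), ENNReal.ofReal_mul (by positivity), mul_assoc]
  refine mul_le_mul' le_rfl ((mul_le_mul' le_rfl h).trans (le_of_eq ?_))
  ring

/-! ### Summation over the lattice -/

theorem tsum_rpow_le_rpow_tsum {ι : Type*} (a : ι → ℝ≥0∞) {p : ℝ} (hp : 1 ≤ p) :
    ∑' i, a i ^ p ≤ (∑' i, a i) ^ p := by
  have h : ∀ x : ℝ≥0∞, x ^ p = x * x ^ (p - 1) := by
    intro x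
    conv_lhs => rw [show p = 1 + (p - 1) by ring]
    rw [ENNReal.rpow_add_of_nonneg _ _ zero_le_one (by linarith), ENNReal.rpow_one]
  rw [h (∑' i, a i), ← ENNReal.tsum_mul_right]
  refine ENNReal.tsum_le_tsum fun i => ?_
  rw [h]
  exact mul_le_mul' le_rfl (ENNReal.rpow_le_rpow (ENNReal.le_tsum i) (by linarith))

theorem pairwise_disjoint_lattice_ball (ε : ℝ) :
    Pairwise (Function.onFun Disjoint fun p : ℤ × ℤ =>
      Metric.ball (!₂[(p.1 : ℝ) * ε, (p.2 : ℝ) * ε] : Plane) (ε / 2)) := by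
  rintro ⟨m, n⟩ ⟨m', n'⟩ hne
  refine Metric.ball_disjoint_ball ?_
  rw [add_halves, EuclideanSpace.dist_eq, Fin.sum_univ_two]
  refine Real.le_sqrt_of_sq_le ?_
  simp only [Real.dist_eq, sq_abs, Matrix.cons_val_zero, Matrix.cons_val_one,
    Matrix.cons_val_fin_one]
  have h : (1 : ℤ) ≤ (m - m') ^ 2 + (n - n') ^ 2 := by
    by_contra! h
    have h1 : m - m' = 0 := by nlinarith [sq_nonneg (m - m'), sq_nonneg (n - n')]
    have h2 : n - n' = 0 := by nlinarith [sq_nonneg (m - m'), sq_nonneg (n - n')]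
    exact hne (Prod.ext (by simpa using sub_eq_zero.1 h1) (by simpa using sub_eq_zero.1 h2))
  have h' : (1 : ℝ) ≤ (m - m') ^ 2 + (n - n') ^ 2 := by exact_mod_cast h
  nlinarith [sq_nonneg ε]

theorem measurableSet_rods (ω₀ : Set Plane) (ε r : ℝ) : MeasurableSet (rods ω₀ ε r) :=
  (isOpen_biUnion fun _ _ => Metric.isOpen_ball).measurableSet

theorem measurable_conductivity (ω₀ : Set Plane) (ε r α : ℝ) :
    Measurable (conductivity ω₀ ε r α) := by
  classical
  unfold conductivity
  exact Measurable.ite (measurableSet_rods ω₀ ε r) measurable_const measurable_const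

theorem conductivity_pos (ω₀ : Set Plane) (ε r : ℝ) {α : ℝ} (hα : 0 < α) (x : Plane) :
    0 < conductivity ω₀ ε r α x := by
  unfold conductivity; split_ifs <;> simp [hα]

theorem setLIntegral_rods_le (ω₀ : Set Plane) (ε r : ℝ) (F : Plane → ℝ≥0∞) :
    ∫⁻ x in rods ω₀ ε r, F x ≤ ∑' p : ℤ × ℤ, ∫⁻ x in rodDisc ε r p.1 p.2, F x := by
  refine (lintegral_mono_set ?_).trans (lintegral_iUnion_le _ _)
  exact Set.iUnion_mono fun p => Set.iUnion_subset fun _ => le_rfl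

/-- `L^s` bound on the rods for small `r`: the disc estimate with `R = ε / 2` and `δ = 2 r`, summed
over the lattice, whose discs of radius `ε / 2` are disjoint. -/
theorem exists_setLIntegral_rods_le {s : ℝ} (hs : 2 ≤ s) : ∃ C : ℝ≥0,
    ∀ φ : Plane → ℝ, ContDiff ℝ 1 φ → ∀ (ω₀ : Set Plane) (ε r : ℝ), 0 < ε → 0 < r → r ≤ 1 / 4 →
      ∫⁻ x in rods ω₀ ε r, ‖φ x‖ₑ ^ s ≤
        ENNReal.ofReal (r ^ 2) * (C * ENNReal.ofReal (ε ^ 2) *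
          ((1 + ENNReal.ofReal (-Real.log r)) * ∫⁻ x, ‖fderiv ℝ φ x‖ₑ ^ 2) ^ (s / 2) +
        C * ∫⁻ x, ‖φ x‖ₑ ^ s) := by
  obtain ⟨C, hC⟩ := exists_lintegral_disc_le hs
  have hs1 : 1 ≤ s / 2 := by linarith
  have hs0 : 0 ≤ s / 2 := by linarith
  refine ⟨4 * C, fun φ hφ ω₀ ε r hε hr hr4 => ?_⟩
  let c : ℤ × ℤ → Plane := fun p => !₂[(p.1 : ℝ) * ε, (p.2 : ℝ) * ε]
  have hdisj := pairwise_disjoint_lattice_ball ε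
  have hsum : ∀ F : Plane → ℝ≥0∞,
      ∑' p : ℤ × ℤ, ∫⁻ x in Metric.ball (c p) (ε / 2), F x ≤ ∫⁻ x, F x := fun F => by
    rw [← lintegral_iUnion (fun p => Metric.isOpen_ball.measurableSet) hdisj]
    exact setLIntegral_le_lintegral _ _
  set L := ENNReal.ofReal (-Real.log r)
  have hdisc : ∀ p : ℤ × ℤ, ∫⁻ x in rodDisc ε r p.1 p.2, ‖φ x‖ₑ ^ s ≤
      ENNReal.ofReal (r ^ 2) * (((4 * C : ℝ≥0) : ℝ≥0∞) * ENNReal.ofReal (ε ^ 2) *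
          ((1 + L) ^ (s / 2) *
            (∫⁻ x in Metric.ball (c p) (ε / 2), ‖fderiv ℝ φ x‖ₑ ^ 2) ^ (s / 2)) +
        ((4 * C : ℝ≥0) : ℝ≥0∞) * ∫⁻ x in Metric.ball (c p) (ε / 2), ‖φ x‖ₑ ^ s) := by
    intro p
    have h := hC φ hφ (c p) (ε / 2) (2 * r) (by positivity) (by positivity) (by linarith)
    rw [show ε / 2 * (2 * r) = ε * r by ring] at h
    refine h.trans ?_
    rw [← ENNReal.mul_rpow_of_nonneg _ _ hs0, show (2 * r) ^ 2 = r ^ 2 * 4 by ring,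
      ENNReal.ofReal_mul (by positivity), ENNReal.ofReal_ofNat, mul_assoc,
      mul_add (4 : ℝ≥0∞), ENNReal.coe_mul, ENNReal.coe_ofNat, mul_assoc 4, mul_assoc 4,
      mul_assoc 4]
    have hlog : -Real.log (2 * r) ≤ -Real.log r := by
      have := Real.log_le_log hr (by linarith : r ≤ 2 * r)
      linarith
    gcongr
    · linarith
    · exact ENNReal.ofReal_le_ofReal hlog
  refine (setLIntegral_rods_le _ _ _ _).trans ((ENNReal.tsum_le_tsum hdisc).trans ?_)
  rw [ENNReal.tsum_mul_left, ENNReal.tsum_add, ENNReal.tsum_mul_left, ENNReal.tsum_mul_left,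
    ENNReal.tsum_mul_left, ENNReal.mul_rpow_of_nonneg _ _ hs0]
  gcongr
  · exact (tsum_rpow_le_rpow_tsum _ hs1).trans (ENNReal.rpow_le_rpow (hsum _) hs0)
  · exact hsum _

/-! ### The weighted inequality for smooth functions -/

/-- The weighted inequality for `C¹` functions with support in `ω`, against the unweighted energy,
with a constant uniform in `ε`, `r`, `α`. -/
theorem exists_weighted_sobolev_const {ω : Set Plane} (ω₀ : Set Plane)
    (hωb : Bornology.IsBounded ω) (κp : ℝ) {γm : ℝ}
    (hγm : 0 < γm) {ε₀ : ℝ} (hε₀ : 0 < ε₀) {s : ℝ} (hs : 2 ≤ s) :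
    ∃ C : ℝ≥0, ∀ ε r α : ℝ, 0 < ε → ε ≤ ε₀ → 0 < r → 0 < α →
      α * (Real.pi * r ^ 2) ≤ κp → -(ε ^ 2 * Real.log r) ≤ 2 * Real.pi / γm →
      ∀ φ : Plane → ℝ, ContDiff ℝ 1 φ → Function.support φ ⊆ ω →
        ∫⁻ x, ENNReal.ofReal (conductivity ω₀ ε r α x) * ‖φ x‖ₑ ^ s ≤
          C * ENNReal.ofReal (ε ^ (2 - s)) * (∫⁻ x, ‖fderiv ℝ φ x‖ₑ ^ 2) ^ (s / 2) := by
  have hs0 : 0 ≤ s / 2 := by linarith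
  obtain ⟨C₁, hC₁⟩ := exists_sobolev_const hs hωb
  obtain ⟨C₂, hC₂⟩ := exists_setLIntegral_rods_le hs
  have hpi := Real.pi_pos
  set B : ℝ := ε₀ ^ 2 + 2 * Real.pi / γm
  have hB : 0 < B := by positivity
  let k : ℝ≥0 := Real.toNNReal κp
  let e₀ : ℝ≥0 := Real.toNNReal (ε₀ ^ (s - 2))
  let b : ℝ≥0 := Real.toNNReal (B ^ (s / 2))
  refine ⟨(1 + k * 16 + k * C₂) * C₁ * e₀ + k * C₂ * b,
    fun ε r α hε hεε₀ hr hα hακ hlog φ hφ hsupp => ?_⟩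
  have hS := hC₁ φ hφ hsupp
  set S := ∫⁻ x, ‖φ x‖ₑ ^ s
  set E := (∫⁻ x, ‖fderiv ℝ φ x‖ₑ ^ 2)
  set X := ENNReal.ofReal (ε ^ (2 - s))
  -- Since `s ≥ 2` and `ε ≤ ε₀`, the factor `ε ^ (2 - s)` is bounded below; this absorbs the
  -- unscaled Sobolev bound for `S`.
  have hX : 1 ≤ (e₀ : ℝ≥0∞) * X := by
    change 1 ≤ ENNReal.ofReal (ε₀ ^ (s - 2)) * ENNReal.ofReal (ε ^ (2 - s))
    rw [← ENNReal.ofReal_mul (by positivity), ← ENNReal.ofReal_one]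
    apply ENNReal.ofReal_le_ofReal
    rw [show 2 - s = -(s - 2) by ring, Real.rpow_neg hε.le, ← div_eq_mul_inv,
      one_le_div (by positivity)]
    exact Real.rpow_le_rpow hε.le hεε₀ (by linarith)
  have hSE : S ≤ C₁ * e₀ * X * E ^ (s / 2) := by
    calc S ≤ C₁ * E ^ (s / 2) := hS
      _ ≤ (e₀ * X) * (C₁ * E ^ (s / 2)) := le_mul_of_one_le_left' hX
      _ = _ := by ring
  have hαr : ENNReal.ofReal α * ENNReal.ofReal (r ^ 2) ≤ k := by
    rw [← ENNReal.ofReal_mul hα.le]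
    apply ENNReal.ofReal_le_ofReal
    have h1 : 0 ≤ α * r ^ 2 := by positivity
    have h2 := Real.pi_gt_three
    nlinarith
  have hpt : ∀ x, ENNReal.ofReal (conductivity ω₀ ε r α x) * ‖φ x‖ₑ ^ s ≤
      ‖φ x‖ₑ ^ s +
        (rods ω₀ ε r).indicator (fun x => ENNReal.ofReal α * ‖φ x‖ₑ ^ s) x := by
    intro x
    by_cases hx : x ∈ rods ω₀ ε r
    · simp [conductivity, hx]
    · simp [conductivity, hx]
  refine (lintegral_mono hpt).trans ?_
  rw [lintegral_add_left (by have := hφ.continuous; fun_prop),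
    lintegral_indicator (measurableSet_rods ω₀ ε r),
    lintegral_const_mul' _ _ ENNReal.ofReal_ne_top]
  -- For `r > 1 / 4` the disc estimate does not apply, but then `α` itself is bounded and the
  -- unweighted inequality suffices.
  rcases le_total r (1 / 4) with hr4 | hr4
  · have hL : ENNReal.ofReal (ε ^ 2) * (1 + ENNReal.ofReal (-Real.log r)) ^ (s / 2) ≤ b * X := by
      have hl0 : 0 ≤ -Real.log r := by
        have := Real.log_nonpos hr.le (by linarith)
        linarith
      change _ ≤ ENNReal.ofReal (B ^ (s / 2)) * ENNReal.ofReal (ε ^ (2 - s))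
      rw [← ENNReal.ofReal_one, ← ENNReal.ofReal_add zero_le_one hl0,
        ENNReal.ofReal_rpow_of_nonneg (by positivity) hs0, ← ENNReal.ofReal_mul (by positivity),
        ← ENNReal.ofReal_mul (by positivity)]
      apply ENNReal.ofReal_le_ofReal
      -- The bound on `-ε² log r` makes the logarithm at most a multiple of `ε⁻²`, and
      -- `ε² (ε⁻²) ^ (s / 2) = ε ^ (2 - s)`.
      have h1 : 1 + -Real.log r ≤ B * (ε ^ 2)⁻¹ := by
        rw [← div_eq_mul_inv, le_div_iff₀ (by positivity)]
        simp only [B]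
        nlinarith
      have h2 : ε ^ 2 * ((ε ^ 2)⁻¹) ^ (s / 2) = ε ^ (2 - s) := by
        rw [← Real.rpow_natCast, ← Real.rpow_neg hε.le, ← Real.rpow_mul hε.le,
          ← Real.rpow_add hε]
        congr 1; push_cast; ring
      calc ε ^ 2 * (1 + -Real.log r) ^ (s / 2) ≤ ε ^ 2 * (B * (ε ^ 2)⁻¹) ^ (s / 2) := by gcongr
        _ = B ^ (s / 2) * (ε ^ 2 * ((ε ^ 2)⁻¹) ^ (s / 2)) := by
          rw [Real.mul_rpow hB.le (by positivity)]; ring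
        _ = _ := by rw [h2]
    have hrod := hC₂ φ hφ ω₀ ε r hε hr hr4
    rw [ENNReal.mul_rpow_of_nonneg _ _ hs0] at hrod
    calc _ ≤ S + ENNReal.ofReal α * (ENNReal.ofReal (r ^ 2) * (C₂ * ENNReal.ofReal (ε ^ 2) *
            ((1 + ENNReal.ofReal (-Real.log r)) ^ (s / 2) * E ^ (s / 2)) + C₂ * S)) := by
          gcongr
      _ = S + (ENNReal.ofReal α * ENNReal.ofReal (r ^ 2)) * (C₂ * (ENNReal.ofReal (ε ^ 2) *
            (1 + ENNReal.ofReal (-Real.log r)) ^ (s / 2)) * E ^ (s / 2) + C₂ * S) := by ring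
      _ ≤ S + k * (C₂ * (b * X) * E ^ (s / 2) + C₂ * S) := by gcongr
      _ = (1 + k * C₂) * S + k * C₂ * b * X * E ^ (s / 2) := by ring
      _ ≤ (1 + k * 16 + k * C₂) * (C₁ * e₀ * X * E ^ (s / 2)) +
            k * C₂ * b * X * E ^ (s / 2) := by
          gcongr
          exact le_self_add
      _ = _ := by push_cast; ring
  · have hα16 : ENNReal.ofReal α ≤ k * 16 := by
      calc ENNReal.ofReal α ≤ ENNReal.ofReal (α * r ^ 2 * 16) := by
            apply ENNReal.ofReal_le_ofReal
            have : 1 ≤ r ^ 2 * 16 := by nlinarith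
            nlinarith
        _ = ENNReal.ofReal α * ENNReal.ofReal (r ^ 2) * 16 := by
            rw [ENNReal.ofReal_mul (by positivity), ENNReal.ofReal_mul hα.le,
              ENNReal.ofReal_ofNat]
        _ ≤ _ := by gcongr
    calc _ ≤ S + (k * 16) * S := by
          gcongr; exact setLIntegral_le_lintegral _ _
      _ = (1 + k * 16) * S := by ring
      _ ≤ (1 + k * 16 + k * C₂) * (C₁ * e₀ * X * E ^ (s / 2)) +
            k * C₂ * b * X * E ^ (s / 2) := by
          exact le_add_right (mul_le_mul' le_self_add hSE)
      _ = _ := by push_cast; ring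

/-! ### Density and passage to `H¹₀` -/

theorem enorm_gradient (φ : Plane → ℝ) (x : Plane) : ‖gradient φ x‖ₑ = ‖fderiv ℝ φ x‖ₑ := by
  rw [← ofReal_norm, ← ofReal_norm, gradient, LinearIsometryEquiv.norm_map]

theorem IsTestFunction.integrableOn_smul {ω : Set Plane} {φ : Plane → ℝ}
    (hφ : IsTestFunction ω φ) {g : Plane → Plane} (hg : LocallyIntegrableOn g ω) :
    IntegrableOn (fun x => φ x • g x) ω := by
  have h1 : IntegrableOn g (tsupport φ) := hg.integrableOn_compact_subset hφ.2.2 hφ.2.1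
  have h2 : IntegrableOn (fun x => φ x • g x) (tsupport φ) :=
    h1.continuousOn_smul hφ.1.continuous.continuousOn hφ.2.1
  refine Integrable.integrableOn ((integrableOn_iff_integrable_of_support_subset ?_).1 h2)
  exact (Function.support_smul_subset_left φ g).trans (subset_tsupport φ)

/-- The weak gradient on an open set is unique almost everywhere. -/
theorem HasWeakGradient.ae_eq {ω : Set Plane} (hω : IsOpen ω) {v : Plane → ℝ}
    {g g' : Plane → Plane} (hg : HasWeakGradient ω v g) (hg' : HasWeakGradient ω v g') :
    g =ᵐ[volume.restrict ω] g' := by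
  have h : ∀ᵐ x, x ∈ ω → (g - g') x = 0 := by
    refine hω.ae_eq_zero_of_integral_contDiff_smul_eq_zero (hg.2.1.sub hg'.2.1)
      fun φ h1 h2 h3 => ?_
    have hφ : IsTestFunction ω φ := ⟨h1, h2, h3⟩
    have e : ∫ x in ω, φ x • g x = ∫ x in ω, φ x • g' x :=
      neg_injective ((hg.2.2 φ hφ).symm.trans (hg'.2.2 φ hφ))
    rw [← setIntegral_eq_integral_of_forall_compl_eq_zero (s := ω)]
    · simp only [Pi.sub_apply, smul_sub]
      rw [integral_sub (hφ.integrableOn_smul hg.2.1) (hφ.integrableOn_smul hg'.2.1), e, sub_self]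
    · intro x hx
      rw [image_eq_zero_of_notMem_tsupport fun hx' => hx (h3 hx'), zero_smul]
  rw [EventuallyEq, ae_restrict_iff' hω.measurableSet]
  filter_upwards [h] with x hx hxω
  exact sub_eq_zero.1 (hx hxω)

/-- A weighted inequality between the `L^s` integral and the energy extends from test functions to
`H¹₀(ω)`: test functions converging in `H¹` converge almost everywhere along a subsequence, and
Fatou's lemma applies. The finiteness of the weighted `L^s` integral is part of the outcome. -/
theorem MemH10.lintegral_le_of_testFunction {ω : Set Plane} (hω : IsOpen ω) {w : Plane → ℝ≥0∞}
    (hw : Measurable w) (hwt : ∀ x, w x ≠ ∞) {s : ℝ} (hs : 0 < s) {K : ℝ≥0∞} (hK : K ≠ ∞)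
    (htest : ∀ φ, IsTestFunction ω φ →
      ∫⁻ x in ω, w x * ‖φ x‖ₑ ^ s ≤ K * (∫⁻ x in ω, ‖gradient φ x‖ₑ ^ 2) ^ (s / 2))
    {v : Plane → ℝ} {g : Plane → Plane} (hv : MemH10 ω v) (hg : HasWeakGradient ω v g) :
    MemLp g 2 (volume.restrict ω) ∧
      ∫⁻ x in ω, w x * ‖v x‖ₑ ^ s ≤ K * (∫⁻ x in ω, ‖g x‖ₑ ^ 2) ^ (s / 2) := by
  obtain ⟨hv2, g', hg'2, hg', φ, hφ, hφv, hφg⟩ := hv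
  have hae := hg.ae_eq hω hg'
  have hg2 : MemLp g 2 (volume.restrict ω) := hg'2.ae_eq hae.symm
  refine ⟨hg2, ?_⟩
  have hpow : ∀ f : Plane → Plane,
      (∫⁻ x in ω, ‖f x‖ₑ ^ 2) ^ (s / 2) = eLpNorm f 2 (volume.restrict ω) ^ s := by
    intro f
    rw [eLpNorm_eq_lintegral_rpow_enorm_toReal (by simp) (by simp)]
    simp only [ENNReal.toReal_ofNat, ENNReal.rpow_ofNat]
    rw [← ENNReal.rpow_mul, one_div_mul_eq_div]
  simp only [hpow] at htest ⊢
  rw [eLpNorm_congr_ae hae]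
  obtain ⟨ns, hns, hlim⟩ := (tendstoInMeasure_of_tendsto_eLpNorm two_ne_zero
    (fun n => (hφ n).1.continuous.aestronglyMeasurable) hv2.1 hφv).exists_seq_tendsto_ae
  have hgrad : ∀ n, AEStronglyMeasurable (gradient (φ n)) (volume.restrict ω) := fun n =>
    ((InnerProductSpace.toDual ℝ Plane).symm.continuous.comp
      ((hφ n).1.continuous_fderiv (by simp))).aestronglyMeasurable
  have hbound : ∀ n, ∫⁻ x in ω, w x * ‖φ (ns n) x‖ₑ ^ s ≤
      K * (eLpNorm (fun x => gradient (φ (ns n)) x - g' x) 2 (volume.restrict ω) +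
        eLpNorm g' 2 (volume.restrict ω)) ^ s := by
    intro n
    refine (htest _ (hφ _)).trans ?_
    gcongr
    have := eLpNorm_add_le (p := 2) ((hgrad (ns n)).sub hg'2.1) hg'2.1 (by norm_num)
    rwa [sub_add_cancel] at this
  have hrhs : Tendsto (fun n => K *
      (eLpNorm (fun x => gradient (φ (ns n)) x - g' x) 2 (volume.restrict ω) +
        eLpNorm g' 2 (volume.restrict ω)) ^ s) atTop
      (𝓝 (K * eLpNorm g' 2 (volume.restrict ω) ^ s)) := by
    refine ENNReal.Tendsto.const_mul ?_ (Or.inr hK)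
    have := ((hφg.comp hns.tendsto_atTop).add_const
      (eLpNorm g' 2 (volume.restrict ω))).ennrpow_const s
    simpa using this
  calc ∫⁻ x in ω, w x * ‖v x‖ₑ ^ s
      = ∫⁻ x in ω, liminf (fun n => w x * ‖φ (ns n) x‖ₑ ^ s) atTop := by
        refine lintegral_congr_ae ?_
        filter_upwards [hlim] with x hx
        exact (ENNReal.Tendsto.const_mul (hx.enorm.ennrpow_const s)
          (Or.inr (hwt x))).liminf_eq.symm
    _ ≤ liminf (fun n => ∫⁻ x in ω, w x * ‖φ (ns n) x‖ₑ ^ s) atTop :=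
        lintegral_liminf_le' fun n =>
          have := (hφ (ns n)).1.continuous
          (by fun_prop : Measurable fun x => w x * ‖φ (ns n) x‖ₑ ^ s).aemeasurable
    _ ≤ liminf (fun n => K *
      (eLpNorm (fun x => gradient (φ (ns n)) x - g' x) 2 (volume.restrict ω) +
        eLpNorm g' 2 (volume.restrict ω)) ^ s) atTop :=
        liminf_le_liminf (Eventually.of_forall hbound)
    _ = _ := hrhs.liminf_eq

theorem lemma12
    (ω ω₀ : Set Plane) (hω : IsOpen ω) (hωb : Bornology.IsBounded ω)
    (hω₀ : closure ω₀ ⊆ ω)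
    (κm κp γm γp : ℝ) (hκm : 0 < κm) (hγm : 0 < γm) (hγp : 0 < γp)
    (ε₀ : ℝ) (hε₀ : 0 < ε₀) (s : ℝ) (hs : 2 ≤ s) :
    ∃ C : ℝ, 0 < C ∧ ∀ ε r α : ℝ, 0 < ε → ε ≤ ε₀ → 0 < r →
      κm ≤ α * (Real.pi * r ^ 2) → α * (Real.pi * r ^ 2) ≤ κp →
      2 * Real.pi / γp ≤ -(ε ^ 2 * Real.log r) → -(ε ^ 2 * Real.log r) ≤ 2 * Real.pi / γm →
      ∀ (v : Plane → ℝ) (g : Plane → Plane), MemH10 ω v → HasWeakGradient ω v g →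
        IntegrableOn (fun x => conductivity ω₀ ε r α x * ‖g x‖ ^ 2) ω ∧
        IntegrableOn (fun x => conductivity ω₀ ε r α x * |v x| ^ s) ω ∧
        ∫ x in ω, conductivity ω₀ ε r α x * |v x| ^ s ≤
          C * ε ^ (2 - s) * (∫ x in ω, conductivity ω₀ ε r α x * ‖g x‖ ^ 2) ^ (s / 2) := by
  have hs0 : 0 < s := by linarith
  have hpi := Real.pi_pos
  obtain ⟨C₁, hC₁⟩ := exists_weighted_sobolev_const ω₀ hωb κp hγm hε₀ hs
  -- Lower bound for the conductivity: `r ≤ 1` forces `α ≥ κm / π`.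
  set c₀ : ℝ := min 1 (κm / Real.pi)
  have hc₀ : 0 < c₀ := by positivity
  refine ⟨(C₁ + 1) * c₀⁻¹ ^ (s / 2), by positivity, ?_⟩
  intro ε r α hε hεε₀ hr hακm hακp hlog1 hlog2 v g hv hg
  have hα : 0 < α := by
    by_contra! h
    have : α * (Real.pi * r ^ 2) ≤ 0 := mul_nonpos_of_nonpos_of_nonneg h (by positivity)
    linarith
  have hr1 : r ≤ 1 := by
    by_contra! h
    have h1 := Real.log_pos h
    have h2 : 0 < 2 * Real.pi / γp := by positivity
    have h3 : 0 < ε ^ 2 * Real.log r := by positivity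
    linarith
  set a := conductivity ω₀ ε r α with ha
  have ham : Measurable a := measurable_conductivity ω₀ ε r α
  have hapos : ∀ x, 0 < a x := conductivity_pos ω₀ ε r hα
  have hac₀ : ∀ x, c₀ ≤ a x := by
    intro x
    have hακ : κm / Real.pi ≤ α := by
      rw [div_le_iff₀ hpi]
      have : r ^ 2 ≤ 1 := pow_le_one₀ hr.le hr1
      have h3 : α * Real.pi * r ^ 2 ≤ α * Real.pi * 1 := by gcongr
      linarith
    rw [ha]
    unfold conductivity
    split_ifs
    · exact (min_le_right _ _).trans hακ
    · exact min_le_left _ _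
  have habdd : ∀ x, a x ≤ 1 + α := by
    intro x
    rw [ha]
    unfold conductivity
    split_ifs <;> linarith
  obtain ⟨hg2, hmain⟩ := hv.lintegral_le_of_testFunction hω (w := fun x => ENNReal.ofReal (a x))
    ham.ennreal_ofReal (fun _ => ENNReal.ofReal_ne_top) hs0
    (K := C₁ * ENNReal.ofReal (ε ^ (2 - s)))
    (ENNReal.mul_ne_top ENNReal.coe_ne_top ENNReal.ofReal_ne_top)
    (fun φ hφ => by
      refine (setLIntegral_le_lintegral _ _).trans
        ((hC₁ ε r α hε hεε₀ hr hα hακp hlog2 φ (hφ.1.of_le (by exact_mod_cast le_top))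
          ((subset_tsupport φ).trans hφ.2.2)).trans (le_of_eq ?_))
      simp only [enorm_gradient]
      rw [setLIntegral_eq_of_support_subset]
      intro x hx
      have h1 : ‖fderiv ℝ φ x‖ₑ ≠ 0 := fun h => hx (by simp [h])
      rw [← ofReal_norm] at h1
      refine hφ.2.2 (support_fderiv_subset ℝ fun h => h1 ?_)
      rw [h, norm_zero, ENNReal.ofReal_zero]) hg
  have hgint : Integrable (fun x => ‖g x‖ ^ 2) (volume.restrict ω) :=
    hg2.integrable_norm_pow two_ne_zero
  have hagint : IntegrableOn (fun x => a x * ‖g x‖ ^ 2) ω :=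
    hgint.bdd_mul ham.aestronglyMeasurable (ae_of_all _ fun x => by
      rw [Real.norm_of_nonneg (hapos x).le]; exact habdd x)
  have hG : ∫⁻ x in ω, ‖g x‖ₑ ^ 2 = ENNReal.ofReal (∫ x in ω, ‖g x‖ ^ 2) := by
    rw [ofReal_integral_eq_lintegral_ofReal hgint (ae_of_all _ fun x => sq_nonneg _)]
    refine lintegral_congr fun x => ?_
    rw [ENNReal.ofReal_pow (norm_nonneg _), ofReal_norm]
  set G := ∫ x in ω, ‖g x‖ ^ 2
  set J := ∫ x in ω, a x * ‖g x‖ ^ 2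
  have hG0 : 0 ≤ G := integral_nonneg fun x => sq_nonneg _
  have hGJ : G ≤ c₀⁻¹ * J := by
    rw [← integral_const_mul]
    refine integral_mono hgint (hagint.const_mul _) fun x => ?_
    simp only
    rw [← mul_assoc]
    refine le_mul_of_one_le_left (sq_nonneg _) ?_
    rw [inv_mul_eq_div, one_le_div hc₀]
    exact hac₀ x
  have hJ0 : 0 ≤ J := integral_nonneg fun x => mul_nonneg (hapos x).le (sq_nonneg _)
  have hnn : ∀ x, 0 ≤ a x * |v x| ^ s := fun x =>
    mul_nonneg (hapos x).le (Real.rpow_nonneg (abs_nonneg _) _)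
  have hofReal : ∀ x, ENNReal.ofReal (a x * |v x| ^ s) =
      ENNReal.ofReal (a x) * ‖v x‖ₑ ^ s := by
    intro x
    rw [ENNReal.ofReal_mul (hapos x).le, ← ENNReal.ofReal_rpow_of_nonneg (abs_nonneg _) hs0.le,
      ← Real.norm_eq_abs, ofReal_norm]
  rw [hG, ENNReal.ofReal_rpow_of_nonneg hG0 (by positivity)] at hmain
  have hfin : ∫⁻ x in ω, ENNReal.ofReal (a x * |v x| ^ s) ≤
      ENNReal.ofReal (C₁ * ε ^ (2 - s) * G ^ (s / 2)) := by
    rw [lintegral_congr hofReal, ENNReal.ofReal_mul (by positivity),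
      ENNReal.ofReal_mul (by positivity), ENNReal.ofReal_coe_nnreal]
    exact hmain
  have hvint : IntegrableOn (fun x => a x * |v x| ^ s) ω := by
    refine ⟨ham.aestronglyMeasurable.mul ?_, ?_⟩
    · exact (hv.1.1.aemeasurable.abs.pow_const s).aestronglyMeasurable
    · rw [hasFiniteIntegral_iff_ofReal (ae_of_all _ hnn)]
      exact hfin.trans_lt ENNReal.ofReal_lt_top
  refine ⟨hagint, hvint, ?_⟩
  rw [← ofReal_integral_eq_lintegral_ofReal hvint (ae_of_all _ hnn),
    ENNReal.ofReal_le_ofReal_iff (by positivity)] at hfin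
  calc _ ≤ C₁ * ε ^ (2 - s) * G ^ (s / 2) := hfin
    _ ≤ (C₁ + 1) * ε ^ (2 - s) * (c₀⁻¹ * J) ^ (s / 2) := by
        gcongr
        linarith
    _ = _ := by rw [Real.mul_rpow (by positivity) hJ0]; ring
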